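/- Let $G=(V,E)$ be a finite directed graph (parallel arcs allowed) with arc capacities $u_e\in\mathbb{R}_{\ge 0}$, a source $s$ and a sink $t\neq s$, with no arc entering $s$ and no arc leaving $t$. Let $\mathcal{X}$ be the set of $s$-$t$-flows, i.e. of $x\in\mathbb{R}^E$ with $0\le x_e\le u_e$ for all $e\in E$ and $\sum_{e\in\delta^-(v)}x_e=\sum_{e\in\delta^+(v)}x_e$ for all $v\in V\setminus\{s,t\}$, and let $\mathrm{Val}(x)=\sum_{e\in\delta^-(t)}x_e$. Let $\mathcal{X}_0\subseteq\mathcal{X}$ be the set of flows that send no flow around a cycle, i.e. such that the arcs with $x_e>0$ contain no directed cycle. Let $\Gamma$ be an integer with $1\le\Gamma\le|E|$, let $\Omega$ be the set of all subsets of $E$ with exactly $\Gamma$ elements, and let $\Delta(\Omega)$ be the set of probability distributions on $\Omega$. For $\mu\in\Omega$ and $x\in\mathcal{X}$ put $$f(\mu,x)=\max\{\mathrm{Val}(y) : y\in\mathcal{X},\ y_e\le x_e\ (e\notin\mu),\ y_e=0\ (e\in\mu)\}.$$ Define the network interdiction value, the arc-based randomized network interdiction value, and the value of the LO model by $$Z_{\mathrm{NI}}=\min_{\mu\in\Omega}\max_{x\in\mathcal{X}}f(\mu,x),\qquad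 Z_{\mathrm{RNI}}=\min_{\alpha\in\Delta(\Omega)}\max_{x\in\mathcal{X}_0}\sum_{\mu\in\Omega}\alpha(\mu)f(\mu,x),$$ $$Z_{\mathrm{LO}}=\max_{\theta\ge 0}\ \max\{\mathrm{Val}(x)-\Gamma\theta : x\in\mathcal{X},\ x_e\le\theta\ \text{for all } e\in E\}.$$ Then $$Z_{\mathrm{NI}}\le(\Gamma+1)\,Z_{\mathrm{LO}}\qquad\text{and}\qquad Z_{\mathrm{RNI}}\le\Gamma\, Z_{\mathrm{LO}}.$$ -/

import Mathlib

open scoped BigOperators Classical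

/-- A flow network: a finite directed graph with node type `V` and arc type `E` (parallel arcs
are allowed), nonnegative real arc capacities, a source and a sink, no arc entering the source
and no arc leaving the sink. -/
structure FlowNetwork (V E : Type*) [Fintype V] [Fintype E] where
  tail : E → V
  head : E → V
  cap : E → ℝ
  cap_nonneg : ∀ e, 0 ≤ cap e
  source : V
  sink : V
  source_ne_sink : source ≠ sink
  head_ne_source : ∀ e, head e ≠ source
  tail_ne_sink : ∀ e, tail e ≠ sink

/-- Pure strategies of the interdictor: the sets of exactly `Γ` arcs (the removed arcs). -/
abbrev Scenario (E : Type*) (Γ : ℕ) : Type _ := {R : Finset E // R.card = Γ}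

namespace FlowNetwork

noncomputable section

variable {V E : Type*} [Fintype V] [Fintype E]

/-- The arcs entering a node. -/
def arcsIn (N : FlowNetwork V E) (v : V) : Finset E := Finset.univ.filter fun e => N.head e = v

/-- The arcs leaving a node. -/
def arcsOut (N : FlowNetwork V E) (v : V) : Finset E := Finset.univ.filter fun e => N.tail e = v

/-- The set of all source-sink flows. -/
def flows (N : FlowNetwork V E) : Set (E → ℝ) :=
  {x | (∀ e, 0 ≤ x e ∧ x e ≤ N.cap e) ∧
    ∀ v, v ≠ N.source → v ≠ N.sink →
      ∑ e ∈ N.arcsIn v, x e - ∑ e ∈ N.arcsOut v, x e = 0}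

/-- The value of a flow: the total flow into the sink. -/
def val (N : FlowNetwork V E) (x : E → ℝ) : ℝ := ∑ e ∈ N.arcsIn N.sink, x e

/-- `x` sends no flow around a cycle: the arcs with `x e > 0` contain no directed cycle. -/
def CycleFree (N : FlowNetwork V E) (x : E → ℝ) : Prop :=
  ∀ v, ¬ Relation.TransGen (fun a b => ∃ e, N.tail e = a ∧ N.head e = b ∧ 0 < x e) v v

/-- The payoff `f(μ, x)`: the maximum value of a flow `y` with `y ≤ x` on the available arcs and
`y = 0` on the removed arcs `R`. -/
def payoff (N : FlowNetwork V E) (R : Finset E) (x : E → ℝ) : ℝ :=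
  sSup (N.val '' {y | y ∈ N.flows ∧ (∀ e, e ∉ R → y e ≤ x e) ∧ ∀ e ∈ R, y e = 0})

/-- Network interdiction: `min_μ max_x f(μ, x)`. -/
def ZNI (N : FlowNetwork V E) (Γ : ℕ) : ℝ :=
  ⨅ μ : Scenario E Γ, sSup ((fun x => N.payoff μ.1 x) '' N.flows)

/-- The expected payoff `f(α, x)` of a mixed strategy `α` of the interdictor. -/
def expectedPayoff (N : FlowNetwork V E) {Γ : ℕ} (α : Scenario E Γ → ℝ) (x : E → ℝ) : ℝ :=
  ∑ μ : Scenario E Γ, α μ * N.payoff μ.1 x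

/-- Arc-based randomized network interdiction: `min_α max_x f(α, x)`, where `α` ranges over the
probability distributions on the scenarios and `x` over the flows that send no flow around a
cycle. -/
def ZRNI (N : FlowNetwork V E) (Γ : ℕ) : ℝ :=
  sInf ((fun α => sSup ((fun x => N.expectedPayoff α x) '' {x | x ∈ N.flows ∧ N.CycleFree x})) ''
    stdSimplex ℝ (Scenario E Γ))

/-- The parametric linear optimization problem `Z_LO(θ)`: maximize `Val(x) - Γ θ` over the flows
`x` bounded by `θ` on every arc. -/
def ZLOAt (N : FlowNetwork V E) (Γ : ℕ) (θ : ℝ) : ℝ :=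
  sSup ((fun x => N.val x - (Γ : ℝ) * θ) '' {x | x ∈ N.flows ∧ ∀ e, x e ≤ θ})

/-- The value of the LO model: `max_{θ ≥ 0} Z_LO(θ)`. -/
def ZLO (N : FlowNetwork V E) (Γ : ℕ) : ℝ := sSup ((fun θ => N.ZLOAt Γ θ) '' Set.Ici 0)

end

end FlowNetwork

namespace FlowNetwork

/-! Write Z for Z_LO and M for the maximum flow value. Truncate the capacities at θ: by max-flow
min-cut, some cut with k arcs of capacity at least θ and remaining capacity r satisfies kθ + r ≤ Z +
Γθ (`exists_cut_ZLO`). For θ just above Z this forces k ≤ Γ, so deleting the k arcs leaves at most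
about (Γ+1)Z. If M > (Γ+1)Z, also k ≥ 1, which improves the bound to about ΓZ. If Z < M ≤ (Γ+1)Z,
take θ just below (M - Z)/Γ ≤ Z and attack a uniformly random one of the k arcs. Attacking e costs
an acyclic flow x at least x_e (`payoff_le_val_sub`), so the payoffs sum to at most (k-1)M + r,
again about kΓZ. -/

/-- Directions in which the nonnegative vector `x` can be moved below `c`. -/
def IsAugmenting {E : Type*} (c x d : E → ℝ) : Prop :=
  ∀ e, (0 < d e → x e < c e) ∧ (d e < 0 → 0 < x e)

/-- Only signs matter, so unit steps along a walk can be added even when arcs repeat. -/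
lemma IsAugmenting.add {E : Type*} {c x d d' : E → ℝ} (h : IsAugmenting c x d)
    (h' : IsAugmenting c x d') :
    IsAugmenting c x (d + d') := by
  intro e
  constructor
  · intro hd
    rw [Pi.add_apply] at hd
    by_cases h0 : 0 < d e
    · exact (h e).1 h0
    · exact (h' e).1 (by linarith)
  · intro hd
    rw [Pi.add_apply] at hd
    by_cases h0 : d e < 0
    · exact (h e).2 h0
    · exact (h' e).2 (by linarith)

/-! ### Net inflow and cuts -/

variable {V E : Type*} [Fintype V] [Fintype E]

/-- The arcs entering the node set `T`. -/
noncomputable def cutArcs (N : FlowNetwork V E) (T : Finset V) : Finset E :=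
  Finset.univ.filter fun e => N.head e ∈ T ∧ N.tail e ∉ T

/-- The arcs leaving the node set `T`. -/
noncomputable def leavingArcs (N : FlowNetwork V E) (T : Finset V) : Finset E :=
  Finset.univ.filter fun e => N.tail e ∈ T ∧ N.head e ∉ T

/-- The net inflow of `x` at the node `v`. -/
noncomputable def excess (N : FlowNetwork V E) (x : E → ℝ) (v : V) : ℝ :=
  ∑ e ∈ N.arcsIn v, x e - ∑ e ∈ N.arcsOut v, x e

variable (N : FlowNetwork V E)

lemma mem_cutArcs {T : Finset V} {e : E} :
    e ∈ N.cutArcs T ↔ N.head e ∈ T ∧ N.tail e ∉ T := by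
  simp [cutArcs]

lemma mem_leavingArcs {T : Finset V} {e : E} :
    e ∈ N.leavingArcs T ↔ N.tail e ∈ T ∧ N.head e ∉ T := by
  simp [leavingArcs]

lemma sum_excess (T : Finset V) (x : E → ℝ) :
    ∑ v ∈ T, N.excess x v = ∑ e ∈ N.cutArcs T, x e - ∑ e ∈ N.leavingArcs T, x e := by
  simp only [excess, arcsIn, arcsOut, cutArcs, leavingArcs, Finset.sum_filter,
    Finset.sum_sub_distrib]
  rw [Finset.sum_comm, Finset.sum_comm (s := T)]
  simp only [Finset.sum_ite_eq]
  rw [← Finset.sum_sub_distrib, ← Finset.sum_sub_distrib]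
  refine Finset.sum_congr rfl fun e _ => ?_
  by_cases h₁ : N.head e ∈ T <;> by_cases h₂ : N.tail e ∈ T <;> simp [h₁, h₂]

lemma excess_sink (x : E → ℝ) : N.excess x N.sink = N.val x := by
  have : N.arcsOut N.sink = ∅ := by
    simp [arcsOut, N.tail_ne_sink]
  simp [excess, val, this]

lemma excess_add (x y : E → ℝ) (v : V) : N.excess (x + y) v = N.excess x v + N.excess y v := by
  simp only [excess, Pi.add_apply, Finset.sum_add_distrib]; ring

lemma excess_sub (x y : E → ℝ) (v : V) : N.excess (x - y) v = N.excess x v - N.excess y v := by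
  simp only [excess, Pi.sub_apply, Finset.sum_sub_distrib]; ring

lemma excess_smul (a : ℝ) (x : E → ℝ) (v : V) : N.excess (a • x) v = a * N.excess x v := by
  simp only [excess, Pi.smul_apply, smul_eq_mul, ← Finset.mul_sum]; ring

lemma excess_single (e : E) (a : ℝ) (v : V) :
    N.excess (Pi.single e a) v
      = (if N.head e = v then a else 0) - (if N.tail e = v then a else 0) := by
  simp [excess, arcsIn, arcsOut, Pi.single_apply]

/-- Flow conservation at all nodes other than the source and the sink. -/
def Conserves (x : E → ℝ) : Prop :=
  ∀ v, v ≠ N.source → v ≠ N.sink → N.excess x v = 0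

lemma Conserves.cut_eq_val {N : FlowNetwork V E} {x : E → ℝ} (hx : N.Conserves x) {T : Finset V}
    (hs : N.source ∉ T) (ht : N.sink ∈ T) :
    N.val x = ∑ e ∈ N.cutArcs T, x e - ∑ e ∈ N.leavingArcs T, x e := by
  rw [← sum_excess, ← excess_sink, Finset.sum_eq_single_of_mem _ ht]
  intro v hv hvt
  exact hx v (fun h => hs (h ▸ hv)) hvt

lemma Conserves.cut_eq_zero {N : FlowNetwork V E} {x : E → ℝ} (hx : N.Conserves x) {T : Finset V}
    (hs : N.source ∉ T) (ht : N.sink ∉ T) :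
    ∑ e ∈ N.cutArcs T, x e - ∑ e ∈ N.leavingArcs T, x e = 0 := by
  rw [← sum_excess]
  exact Finset.sum_eq_zero fun v hv => hx v (fun h => hs (h ▸ hv)) (fun h => ht (h ▸ hv))

lemma val_le_cut {x : E → ℝ} (hx : x ∈ N.flows) {T : Finset V}
    (hs : N.source ∉ T) (ht : N.sink ∈ T) : N.val x ≤ ∑ e ∈ N.cutArcs T, x e := by
  rw [Conserves.cut_eq_val hx.2 hs ht]
  linarith [Finset.sum_nonneg fun e (_ : e ∈ N.leavingArcs T) => (hx.1 e).1]

lemma val_nonneg {x : E → ℝ} (hx : ∀ e, 0 ≤ x e) : 0 ≤ N.val x :=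
  Finset.sum_nonneg fun e _ => hx e

lemma val_le_val {x y : E → ℝ} (h : ∀ e, x e ≤ y e) : N.val x ≤ N.val y :=
  Finset.sum_le_sum fun e _ => h e

lemma zero_mem_flows : (0 : E → ℝ) ∈ N.flows :=
  ⟨fun e => ⟨le_rfl, N.cap_nonneg e⟩, by simp⟩

/-! ### Maximum flows and minimum cuts -/

/-- A flow step along a residual arc. -/
def ResidualArc (c x : E → ℝ) (a b : V) : Prop :=
  ∃ e, (N.tail e = a ∧ N.head e = b ∧ x e < c e) ∨ (N.head e = a ∧ N.tail e = b ∧ 0 < x e)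

lemma exists_augmenting {c x : E → ℝ} {v : V}
    (h : Relation.ReflTransGen (N.ResidualArc c x) N.source v) :
    ∃ d, IsAugmenting c x d ∧
      ∀ w, N.excess d w = (if w = v then 1 else 0) - (if w = N.source then 1 else 0) := by
  induction h with
  | refl => exact ⟨0, by simp [IsAugmenting], by simp [excess]⟩
  | @tail a b _ hab ih =>
    obtain ⟨d, hd, hexc⟩ := ih
    obtain ⟨e, ⟨rfl, rfl, he⟩ | ⟨rfl, rfl, he⟩⟩ := hab
    · refine ⟨d + Pi.single e 1, hd.add fun f => ?_, fun w => ?_⟩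
      · by_cases hf : f = e
        · subst hf; simp [he, zero_le_one.not_gt]
        · simp [hf]
      · rw [excess_add, hexc, excess_single]
        simp only [eq_comm (b := w)]; ring
    · refine ⟨d + Pi.single e (-1), hd.add fun f => ?_, fun w => ?_⟩
      · by_cases hf : f = e
        · subst hf; simp [he, zero_le_one.not_gt]
        · simp [hf]
      · rw [excess_add, hexc, excess_single]
        simp only [eq_comm (b := w)]; split_ifs <;> ring

lemma IsAugmenting.exists_pos {c x d : E → ℝ} (hx : ∀ e, 0 ≤ x e ∧ x e ≤ c e)
    (hd : IsAugmenting c x d) : ∃ ε > 0, ∀ e, 0 ≤ x e + ε * d e ∧ x e + ε * d e ≤ c e := by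
  have key : ∀ e, ∀ᶠ ε in nhdsWithin (0 : ℝ) (Set.Ioi 0),
      0 ≤ x e + ε * d e ∧ x e + ε * d e ≤ c e := by
    intro e
    have hlim : Filter.Tendsto (fun ε : ℝ => x e + ε * d e) (nhdsWithin 0 (Set.Ioi 0))
        (nhds (x e)) := by
      have : Continuous fun ε : ℝ => x e + ε * d e := by fun_prop
      simpa using (this.tendsto 0).mono_left nhdsWithin_le_nhds
    have hpos : ∀ᶠ ε in nhdsWithin (0 : ℝ) (Set.Ioi 0), 0 < ε := self_mem_nhdsWithin
    refine Filter.Eventually.and ?_ ?_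
    · by_cases h : d e < 0
      · filter_upwards [hlim.eventually (lt_mem_nhds ((hd e).2 h))] with ε hε using hε.le
      · filter_upwards [hpos] with ε hε
        have := mul_nonneg hε.le (not_lt.1 h)
        linarith [(hx e).1]
    · by_cases h : 0 < d e
      · filter_upwards [hlim.eventually (gt_mem_nhds ((hd e).1 h))] with ε hε using hε.le
      · filter_upwards [hpos] with ε hε
        have := mul_nonneg hε.le (neg_nonneg.2 (not_lt.1 h))
        linarith [(hx e).2]
  obtain ⟨ε, hε, hpos⟩ := ((Filter.eventually_all.2 key).and
    (self_mem_nhdsWithin : ∀ᶠ ε in nhdsWithin (0 : ℝ) (Set.Ioi 0), 0 < ε)).exists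
  exact ⟨ε, hpos, hε⟩

lemma continuous_excess (v : V) : Continuous fun x => N.excess x v := by
  unfold excess; fun_prop

lemma continuous_val : Continuous N.val := by
  unfold val; fun_prop

/-- Max-flow min-cut: some flow below `c` has the value of some cut with respect to `c`. -/
lemma exists_flow_cut {c : E → ℝ} (hc : ∀ e, 0 ≤ c e) :
    ∃ x, (∀ e, 0 ≤ x e ∧ x e ≤ c e) ∧ N.Conserves x ∧
      ∃ T : Finset V, N.source ∉ T ∧ N.sink ∈ T ∧ N.val x = ∑ e ∈ N.cutArcs T, c e := by
  have hcomp : IsCompact {x : E → ℝ | (∀ e, 0 ≤ x e ∧ x e ≤ c e) ∧ N.Conserves x} := by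
    have hbox : {x : E → ℝ | (∀ e, 0 ≤ x e ∧ x e ≤ c e) ∧ N.Conserves x}
        = Set.Icc 0 c ∩ {x | N.Conserves x} := by
      ext x
      simp only [Set.mem_ofPred_eq, Set.mem_inter_iff, Set.mem_Icc, Pi.le_def, Pi.zero_apply,
        forall_and]
    rw [hbox]
    refine isCompact_Icc.inter_right ?_
    simp only [Conserves, Set.ofPred_forall]
    exact isClosed_iInter fun v => isClosed_iInter fun _ => isClosed_iInter fun _ =>
      isClosed_eq (N.continuous_excess v) continuous_const
  obtain ⟨x, ⟨hxc, hcons⟩, hmax⟩ := hcomp.exists_isMaxOn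
    ⟨0, fun e => ⟨le_rfl, hc e⟩, fun v _ _ => by simp [excess]⟩ N.continuous_val.continuousOn
  refine ⟨x, hxc, hcons,
    Finset.univ.filter fun v => ¬ Relation.ReflTransGen (N.ResidualArc c x) N.source v, ?_⟩
  have hs : N.source ∉ Finset.univ.filter
      fun v => ¬ Relation.ReflTransGen (N.ResidualArc c x) N.source v := by
    simp [Relation.ReflTransGen.refl]
  have ht : N.sink ∈ Finset.univ.filter
      fun v => ¬ Relation.ReflTransGen (N.ResidualArc c x) N.source v := by
    simp only [Finset.mem_filter, Finset.mem_univ, true_and]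
    intro hreach
    obtain ⟨d, hd, hexc⟩ := N.exists_augmenting hreach
    obtain ⟨ε, hε, hbd⟩ := hd.exists_pos hxc
    have hle : N.val (x + ε • d) ≤ N.val x := hmax (a := x + ε • d) ⟨hbd, fun v hvs hvt => by
      rw [excess_add, excess_smul, hcons v hvs hvt, hexc]; simp [hvs, hvt]⟩
    rw [← excess_sink, excess_add, excess_smul, hexc, excess_sink] at hle
    simp [N.source_ne_sink.symm] at hle
    linarith
  refine ⟨hs, ht, ?_⟩
  rw [hcons.cut_eq_val hs ht]
  have h₁ : ∀ e ∈ N.leavingArcs (Finset.univ.filter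
      fun v => ¬ Relation.ReflTransGen (N.ResidualArc c x) N.source v), x e = 0 := by
    intro e he
    simp only [mem_leavingArcs, Finset.mem_filter, Finset.mem_univ, true_and, not_not] at he
    by_contra hne
    exact he.1 (he.2.tail ⟨e, .inr ⟨rfl, rfl, lt_of_le_of_ne (hxc e).1 (Ne.symm hne)⟩⟩)
  have h₂ : ∀ e ∈ N.cutArcs (Finset.univ.filter
      fun v => ¬ Relation.ReflTransGen (N.ResidualArc c x) N.source v), x e = c e := by
    intro e he
    simp only [mem_cutArcs, Finset.mem_filter, Finset.mem_univ, true_and, not_not] at he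
    by_contra hne
    exact he.1 (he.2.tail ⟨e, .inl ⟨rfl, rfl, lt_of_le_of_ne (hxc e).2 hne⟩⟩)
  rw [Finset.sum_eq_zero h₁, sub_zero]
  exact Finset.sum_congr rfl h₂

/-! ### Acyclic flows -/

/-- In a cycle-free conserving vector, the value is at least the flow on every arc. -/
lemma le_val_of_cycleFree {z : E → ℝ} (hz : ∀ e, 0 ≤ z e) (hcons : N.Conserves z)
    (hcf : N.CycleFree z) (e : E) : z e ≤ N.val z := by
  rcases (hz e).eq_or_lt with h0 | hpos
  · rw [← h0]; exact N.val_nonneg hz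
  let r : V → V → Prop := fun a b => ∃ e, N.tail e = a ∧ N.head e = b ∧ 0 < z e
  -- No positive arc leaves `T`, and acyclicity makes `e` enter it, so the net inflow of `T` is at
  -- least `z e`. Conservation then forces the sink into `T`.
  let T : Finset V := Finset.univ.filter fun v => Relation.ReflTransGen r (N.head e) v
  have memT : ∀ v, v ∈ T ↔ Relation.ReflTransGen r (N.head e) v := fun v => by simp [T]
  have hs : N.source ∉ T := by
    rw [memT]
    intro h
    rcases Relation.ReflTransGen.cases_tail h with h | ⟨a, _, f, _, hf, _⟩
    · exact N.head_ne_source e h.symm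
    · exact N.head_ne_source f hf
  have hleave : ∑ f ∈ N.leavingArcs T, z f = 0 := by
    refine Finset.sum_eq_zero fun f hf => ?_
    rw [mem_leavingArcs, memT, memT] at hf
    by_contra hne
    exact hf.2 (hf.1.tail ⟨f, rfl, rfl, lt_of_le_of_ne (hz f) (Ne.symm hne)⟩)
  have hmem : e ∈ N.cutArcs T := by
    rw [mem_cutArcs, memT, memT]
    refine ⟨.refl, fun h => hcf (N.head e) ?_⟩
    exact Relation.TransGen.tail' h ⟨e, rfl, rfl, hpos⟩
  have hle : z e ≤ ∑ f ∈ N.cutArcs T, z f :=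
    Finset.single_le_sum (f := z) (fun f _ => hz f) hmem
  by_cases ht : N.sink ∈ T
  · rw [hcons.cut_eq_val hs ht]; linarith
  · have := hcons.cut_eq_zero hs ht
    linarith

lemma CycleFree.mono {N : FlowNetwork V E} {x z : E → ℝ} (hx : N.CycleFree x)
    (h : ∀ e, z e ≤ x e) : N.CycleFree z := fun v hv =>
  hx v (Relation.TransGen.mono
    (fun _ _ ⟨e, h₁, h₂, h₃⟩ => ⟨e, h₁, h₂, h₃.trans_le (h e)⟩) _ _ hv)

/-! ### Payoffs -/

lemma payoff_le {R : Finset E} {x : E → ℝ} (hx : ∀ e, 0 ≤ x e) {a : ℝ}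
    (h : ∀ y ∈ N.flows, (∀ e, e ∉ R → y e ≤ x e) → (∀ e ∈ R, y e = 0) → N.val y ≤ a) :
    N.payoff R x ≤ a := by
  refine csSup_le ⟨_, 0, ⟨N.zero_mem_flows, fun e _ => hx e, fun _ _ => rfl⟩, rfl⟩ ?_
  rintro _ ⟨y, ⟨hy, h₁, h₂⟩, rfl⟩
  exact h y hy h₁ h₂

lemma payoff_nonneg (R : Finset E) (x : E → ℝ) : 0 ≤ N.payoff R x := by
  refine Real.sSup_nonneg ?_
  rintro _ ⟨y, ⟨hy, -⟩, rfl⟩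
  exact N.val_nonneg fun e => (hy.1 e).1

/-- For a surviving flow y, x - y is conserving and cycle-free and carries all of `x e` on `e`, so
its value is at least `x e`. -/
lemma payoff_le_val_sub {R : Finset E} {x : E → ℝ} (hx : x ∈ N.flows) (hcf : N.CycleFree x)
    {e : E} (he : e ∈ R) : N.payoff R x ≤ N.val x - x e := by
  refine N.payoff_le (fun e => (hx.1 e).1) fun y hy h₁ h₂ => ?_
  have hyx : ∀ f, y f ≤ x f := fun f => by
    by_cases hf : f ∈ R
    · rw [h₂ f hf]; exact (hx.1 f).1
    · exact h₁ f hf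
  have := N.le_val_of_cycleFree (z := x - y) (fun f => sub_nonneg.2 (hyx f))
    (fun v hs ht => by
      rw [excess_sub]
      have h₁ : N.excess x v = 0 := hx.2 v hs ht
      have h₂ : N.excess y v = 0 := hy.2 v hs ht
      rw [h₁, h₂, sub_zero])
    (hcf.mono fun f => sub_le_self _ (hy.1 f).1) e
  rw [← excess_sink, excess_sub, excess_sink, excess_sink, Pi.sub_apply, h₂ e he] at this
  linarith

lemma payoff_le_cut {R A : Finset E} {x : E → ℝ} (hx : x ∈ N.flows) {T : Finset V}
    (hs : N.source ∉ T) (ht : N.sink ∈ T) (hA : A ⊆ R) :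
    N.payoff R x ≤ ∑ e ∈ N.cutArcs T \ A, N.cap e := by
  refine N.payoff_le (fun e => (hx.1 e).1) fun y hy _ h₂ => ?_
  calc N.val y ≤ ∑ e ∈ N.cutArcs T, y e := N.val_le_cut hy hs ht
    _ = ∑ e ∈ N.cutArcs T \ A, y e := by
      refine (Finset.sum_subset Finset.sdiff_subset fun e he hne => h₂ e (hA ?_)).symm
      by_contra h
      exact hne (Finset.mem_sdiff.2 ⟨he, h⟩)
    _ ≤ _ := Finset.sum_le_sum fun e _ => (hy.1 e).2

/-! ### The three values -/

lemma val_sub_le_ZLO (Γ : ℕ) {x : E → ℝ} (hx : x ∈ N.flows) {θ : ℝ} (hθ : 0 ≤ θ)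
    (hxθ : ∀ e, x e ≤ θ) : N.val x - Γ * θ ≤ N.ZLO Γ := by
  -- An unbounded real `sSup` would be 0; this bounds both nested suprema.
  have hbd : ∀ η : ℝ, 0 ≤ η → ∀ y ∈ N.flows, N.val y - Γ * η ≤ N.val N.cap := by
    intro η hη y hy
    have h₁ := N.val_le_val fun e => (hy.1 e).2
    have h₂ : 0 ≤ (Γ : ℝ) * η := by positivity
    linarith
  refine le_trans (b := N.ZLOAt Γ θ) ?_ ?_
  · refine le_csSup ⟨N.val N.cap, ?_⟩ ⟨x, ⟨hx, hxθ⟩, rfl⟩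
    rintro _ ⟨y, ⟨hy, -⟩, rfl⟩
    exact hbd θ hθ y hy
  · refine le_csSup ⟨N.val N.cap, ?_⟩ ⟨θ, hθ, rfl⟩
    rintro _ ⟨η, hη, rfl⟩
    refine csSup_le ⟨_, 0, ⟨N.zero_mem_flows, fun _ => hη⟩, rfl⟩ ?_
    rintro _ ⟨y, ⟨hy, -⟩, rfl⟩
    exact hbd η hη y hy

lemma ZLO_nonneg (Γ : ℕ) : 0 ≤ N.ZLO Γ := by
  simpa [val] using N.val_sub_le_ZLO Γ N.zero_mem_flows le_rfl fun _ => le_rfl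

/-- For every `θ ≥ 0` there is a cut with `k` distinguished arcs (those of capacity at least `θ`)
such that `k` and the total capacity of the other arcs satisfy `k θ + rest ≤ Z_LO + Γ θ`. -/
lemma exists_cut_ZLO (Γ : ℕ) {θ : ℝ} (hθ : 0 ≤ θ) :
    ∃ T : Finset V, N.source ∉ T ∧ N.sink ∈ T ∧ ∃ B ⊆ N.cutArcs T,
      B.card * θ + ∑ e ∈ N.cutArcs T \ B, N.cap e ≤ N.ZLO Γ + Γ * θ := by
  obtain ⟨x, hx, hcons, T, hs, ht, hval⟩ :=
    N.exists_flow_cut (c := fun e => min (N.cap e) θ) fun e => le_min (N.cap_nonneg e) hθ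
  have hZ := N.val_sub_le_ZLO Γ (x := x)
    ⟨fun e => ⟨(hx e).1, (hx e).2.trans (min_le_left _ _)⟩, hcons⟩ hθ
    fun e => (hx e).2.trans (min_le_right _ _)
  refine ⟨T, hs, ht, (N.cutArcs T).filter fun e => θ ≤ N.cap e, Finset.filter_subset _ _, ?_⟩
  · rw [hval, ← Finset.sum_sdiff (Finset.filter_subset (fun e => θ ≤ N.cap e) (N.cutArcs T)),
      Finset.sum_congr (g := N.cap) rfl, Finset.sum_congr (g := fun _ => θ)
        (s₁ := (N.cutArcs T).filter fun e => θ ≤ N.cap e) rfl] at hZ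
    · simp only [Finset.sum_const, nsmul_eq_mul] at hZ
      linarith
    · intro e he
      exact min_eq_right (Finset.mem_filter.1 he).2
    · intro e he
      simp only [Finset.mem_sdiff, Finset.mem_filter, not_and, not_le] at he
      exact min_eq_left (he.2 he.1).le

/-! ### Bounds from particular interdictor strategies -/

lemma exists_scenario {Γ : ℕ} (hΓE : Γ ≤ Fintype.card E) {B : Finset E} (hB : B.card ≤ Γ) :
    ∃ μ : Scenario E Γ, B ⊆ μ.1 := by
  obtain ⟨R, hBR, -, hR⟩ := Finset.exists_subsuperset_card_eq (Finset.subset_univ B) hB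
    (by simpa using hΓE)
  exact ⟨⟨R, hR⟩, hBR⟩

lemma ZNI_le {Γ : ℕ} (μ : Scenario E Γ) {a : ℝ} (h : ∀ x ∈ N.flows, N.payoff μ.1 x ≤ a) :
    N.ZNI Γ ≤ a := by
  refine (ciInf_le (Set.finite_range _).bddBelow μ).trans
    (csSup_le ⟨_, 0, N.zero_mem_flows, rfl⟩ ?_)
  rintro _ ⟨x, hx, rfl⟩
  exact h x hx

lemma ZRNI_le {Γ : ℕ} {α : Scenario E Γ → ℝ} (hα : α ∈ stdSimplex ℝ (Scenario E Γ)) {a : ℝ}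
    (h : ∀ x ∈ N.flows, N.CycleFree x → N.expectedPayoff α x ≤ a) : N.ZRNI Γ ≤ a := by
  refine (csInf_le ⟨0, ?_⟩ (Set.mem_image_of_mem _ hα)).trans
    (csSup_le ⟨_, Set.mem_image_of_mem _ ⟨N.zero_mem_flows, fun v hv => ?_⟩⟩ ?_)
  · rintro _ ⟨β, hβ, rfl⟩
    refine Real.sSup_nonneg ?_
    rintro _ ⟨x, -, rfl⟩
    exact Finset.sum_nonneg fun μ _ => mul_nonneg (hβ.1 μ) (N.payoff_nonneg _ _)
  · obtain ⟨b, ⟨e, -, -, he⟩, -⟩ := Relation.TransGen.head'_iff.1 hv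
    exact lt_irrefl _ he
  · rintro _ ⟨x, ⟨hx, hcf⟩, rfl⟩
    exact h x hx hcf

/-- The interdictor draws `e` uniformly from `B` and plays `σ e`. Since `σ` may not be injective,
the weight of `μ` is summed over its preimages. -/
lemma ZRNI_le_uniform {Γ : ℕ} {B : Finset E} (hB : B.Nonempty) (σ : E → Scenario E Γ) {a : ℝ}
    (h : ∀ x ∈ N.flows, N.CycleFree x → ∑ e ∈ B, N.payoff (σ e).1 x ≤ B.card * a) :
    N.ZRNI Γ ≤ a := by
  have hk : (0 : ℝ) < B.card := by exact_mod_cast hB.card_pos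
  refine N.ZRNI_le (α := fun μ => ∑ e ∈ B, if σ e = μ then (B.card : ℝ)⁻¹ else 0)
    ⟨fun μ => Finset.sum_nonneg fun e _ => by split_ifs <;> positivity, ?_⟩ fun x hx hcf => ?_
  · rw [Finset.sum_comm]
    simp [hk.ne']
  · have : N.expectedPayoff (fun μ => ∑ e ∈ B, if σ e = μ then (B.card : ℝ)⁻¹ else 0) x
        = (B.card : ℝ)⁻¹ * ∑ e ∈ B, N.payoff (σ e).1 x := by
      simp only [expectedPayoff, Finset.sum_mul]
      rw [Finset.sum_comm]
      simp [Finset.mul_sum]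
    rw [this, inv_mul_le_iff₀ hk]
    exact h x hx hcf

lemma ZRNI_le_pure {Γ : ℕ} (hΓ : 1 ≤ Γ) (hΓE : Γ ≤ Fintype.card E) (μ : Scenario E Γ) {a : ℝ}
    (h : ∀ x ∈ N.flows, N.payoff μ.1 x ≤ a) : N.ZRNI Γ ≤ a := by
  obtain ⟨e⟩ : Nonempty E := Fintype.card_pos_iff.1 (hΓ.trans hΓE)
  refine N.ZRNI_le_uniform (Finset.singleton_nonempty e) (fun _ => μ) fun x hx _ => ?_
  simpa using h x hx

/-! ### The two inequalities -/

lemma ZNI_le_ZLO {Γ : ℕ} (hΓE : Γ ≤ Fintype.card E) : N.ZNI Γ ≤ ((Γ : ℝ) + 1) * N.ZLO Γ := by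
  have hZ := N.ZLO_nonneg Γ
  refine le_of_forall_pos_le_add fun δ hδ => ?_
  obtain ⟨ε, hε, hεδ⟩ : ∃ ε > 0, (Γ : ℝ) * ε ≤ δ :=
    ⟨δ / (Γ + 1), by positivity, by
      rw [mul_div_assoc', div_le_iff₀ (by positivity)]; nlinarith⟩
  obtain ⟨T, hs, ht, B, -, hle⟩ := N.exists_cut_ZLO Γ (θ := N.ZLO Γ + ε) (by linarith)
  have hrest : 0 ≤ ∑ e ∈ N.cutArcs T \ B, N.cap e := Finset.sum_nonneg fun e _ => N.cap_nonneg e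
  have hB : B.card ≤ Γ := by
    -- Γ + 1 large arcs would give θ ≤ Z; the slack ε excludes this.
    by_contra! hlt
    have : (Γ : ℝ) + 1 ≤ B.card := by exact_mod_cast hlt
    nlinarith
  obtain ⟨μ, hμ⟩ := exists_scenario hΓE hB
  refine N.ZNI_le μ fun x hx => (N.payoff_le_cut hx hs ht hμ).trans ?_
  have : 0 ≤ (B.card : ℝ) * (N.ZLO Γ + ε) := by positivity
  linarith

lemma ZRNI_le_ZLO {Γ : ℕ} (hΓ : 1 ≤ Γ) (hΓE : Γ ≤ Fintype.card E) :
    N.ZRNI Γ ≤ (Γ : ℝ) * N.ZLO Γ := by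
  have hZ := N.ZLO_nonneg Γ
  have hΓ' : (1 : ℝ) ≤ Γ := by exact_mod_cast hΓ
  obtain ⟨w, hw, hwc, T₀, hs₀, ht₀, hw₀⟩ := N.exists_flow_cut N.cap_nonneg
  set M := N.val w with hM
  have hmin : ∀ T : Finset V, N.source ∉ T → N.sink ∈ T → M ≤ ∑ e ∈ N.cutArcs T, N.cap e :=
    fun T hs ht => (N.val_le_cut ⟨hw, hwc⟩ hs ht).trans (Finset.sum_le_sum fun e _ => (hw e).2)
  have hmax : ∀ x ∈ N.flows, N.val x ≤ M := fun x hx =>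
    (N.val_le_cut hx hs₀ ht₀).trans (hw₀ ▸ Finset.sum_le_sum fun e _ => (hx.1 e).2)
  -- a cut whose capacity exceeds `Z_LO + Γ θ` has an arc of capacity at least `θ`
  have hbig : ∀ (T : Finset V) (θ : ℝ) (B : Finset E), N.source ∉ T → N.sink ∈ T →
      B.card * θ + ∑ e ∈ N.cutArcs T \ B, N.cap e ≤ N.ZLO Γ + Γ * θ →
      N.ZLO Γ + Γ * θ < M → B.Nonempty := by
    intro T θ B hs ht hle hlt
    by_contra hB
    rw [Finset.not_nonempty_iff_eq_empty] at hB
    subst hB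
    simp only [Finset.card_empty, Nat.cast_zero, zero_mul, zero_add, Finset.sdiff_empty] at hle
    linarith [hmin T hs ht]
  refine le_of_forall_pos_le_add fun δ hδ => ?_
  by_cases hcase : ((Γ : ℝ) + 1) * N.ZLO Γ < M
  -- The first term keeps the final error below δ, the second keeps Z + Γθ below M, as `hbig` needs.
  · set ε := min (δ / Γ) ((M - (Γ + 1) * N.ZLO Γ) / (2 * Γ)) with hεdef
    have hε : 0 < ε := lt_min (by positivity) (div_pos (by linarith) (by positivity))
    have hε₁ : Γ * ε ≤ δ := by
      have := min_le_left (δ / Γ) ((M - (Γ + 1) * N.ZLO Γ) / (2 * Γ))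
      rw [← hεdef, le_div_iff₀ (by positivity)] at this
      linarith
    have hε₂ : 2 * (Γ * ε) ≤ M - (Γ + 1) * N.ZLO Γ := by
      have := min_le_right (δ / Γ) ((M - (Γ + 1) * N.ZLO Γ) / (2 * Γ))
      rw [← hεdef, le_div_iff₀ (by positivity)] at this
      linarith
    have hΓε : 0 < Γ * ε := by positivity
    obtain ⟨T, hs, ht, B, -, hle⟩ := N.exists_cut_ZLO Γ (θ := N.ZLO Γ + ε) (by linarith)
    have hrest : 0 ≤ ∑ e ∈ N.cutArcs T \ B, N.cap e :=
      Finset.sum_nonneg fun e _ => N.cap_nonneg e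
    have hBne : B.Nonempty := hbig T _ B hs ht hle (by linarith)
    have hB1 : (1 : ℝ) ≤ B.card := by exact_mod_cast hBne.card_pos
    have hB : B.card ≤ Γ := by
      by_contra! hlt
      have : (Γ : ℝ) + 1 ≤ B.card := by exact_mod_cast hlt
      nlinarith
    obtain ⟨μ, hμ⟩ := exists_scenario hΓE hB
    refine N.ZRNI_le_pure hΓ hΓE μ fun x hx => (N.payoff_le_cut hx hs ht hμ).trans ?_
    -- As k ≥ 1, the rest of the cut is at most Z + (Γ-1)θ.
    nlinarith
  · rw [not_lt] at hcase
    by_cases hMZ : M ≤ N.ZLO Γ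
    · obtain ⟨μ, -⟩ := exists_scenario hΓE (B := ∅) (by simp)
      refine N.ZRNI_le_pure hΓ hΓE μ fun x hx => ?_
      refine N.payoff_le (fun e => (hx.1 e).1) fun y hy _ _ => ?_
      nlinarith [hmax y hy]
    rw [not_le] at hMZ
    -- θ₁ solves Z + Γθ = M; lowering it by ε gives the strict inequality required by `hbig`.
    obtain ⟨θ₁, hθ₁⟩ : ∃ θ₁ : ℝ, Γ * θ₁ = M - N.ZLO Γ := ⟨(M - N.ZLO Γ) / Γ, by field_simp⟩
    have hθpos : 0 < θ₁ := by
      by_contra! h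
      nlinarith
    have hθle : θ₁ ≤ N.ZLO Γ := by
      refine le_of_mul_le_mul_left (a := (Γ : ℝ)) ?_ (by linarith)
      linarith
    obtain ⟨ε, hε, hεδ, hεθ⟩ : ∃ ε > 0, ε ≤ δ ∧ ε ≤ θ₁ :=
      ⟨min δ θ₁, lt_min hδ hθpos, min_le_left _ _, min_le_right _ _⟩
    obtain ⟨T, hs, ht, B, hBT, hle⟩ := N.exists_cut_ZLO Γ (θ := θ₁ - ε) (by linarith)
    have hBne : B.Nonempty := hbig T _ B hs ht hle (by nlinarith)
    have hB1 : (1 : ℝ) ≤ B.card := by exact_mod_cast hBne.card_pos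
    have hsing : ∀ e : E, ∃ μ : Scenario E Γ, {e} ⊆ μ.1 := fun e =>
      exists_scenario hΓE (by simpa using hΓ)
    choose σ hσ using hsing
    refine N.ZRNI_le_uniform hBne σ fun x hx hcf => ?_
    have h₁ : ∑ e ∈ B, N.payoff (σ e).1 x ≤ ∑ e ∈ B, (N.val x - x e) :=
      Finset.sum_le_sum fun e _ => N.payoff_le_val_sub hx hcf (by simpa using hσ e)
    rw [Finset.sum_sub_distrib, Finset.sum_const, nsmul_eq_mul] at h₁
    have h₂ := N.val_le_cut hx hs ht
    rw [← Finset.sum_sdiff hBT] at h₂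
    have h₃ : ∑ e ∈ N.cutArcs T \ B, x e ≤ ∑ e ∈ N.cutArcs T \ B, N.cap e :=
      Finset.sum_le_sum fun e _ => (hx.1 e).2
    have h₄ : ((B.card : ℝ) - 1) * N.val x ≤ ((B.card : ℝ) - 1) * M :=
      mul_le_mul_of_nonneg_left (hmax x hx) (by linarith)
    have h₅ : (B.card : ℝ) * ((Γ - 1) * θ₁) ≤ B.card * ((Γ - 1) * N.ZLO Γ) :=
      mul_le_mul_of_nonneg_left (mul_le_mul_of_nonneg_left hθle (by linarith)) (by linarith)
    have h₆ : (B.card : ℝ) * ε ≤ B.card * δ := mul_le_mul_of_nonneg_left hεδ (by linarith)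
    have h₇ : 0 ≤ Γ * ε := by positivity
    have hMeq : M = N.ZLO Γ + Γ * θ₁ := by linarith
    rw [hMeq] at h₄
    -- With k = |B|: (k-1)M + Z + (Γ-k)(θ₁-ε) = kZ + k(Γ-1)θ₁ + (k-Γ)ε.
    nlinarith

end FlowNetwork

theorem mainTheorem3 {V E : Type*} [Fintype V] [Fintype E] (N : FlowNetwork V E)
    (Γ : ℕ) (hΓ : 1 ≤ Γ) (hΓE : Γ ≤ Fintype.card E) :
    N.ZNI Γ ≤ ((Γ : ℝ) + 1) * N.ZLO Γ ∧ N.ZRNI Γ ≤ (Γ : ℝ) * N.ZLO Γ :=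
  ⟨N.ZNI_le_ZLO hΓE, N.ZRNI_le_ZLO hΓ hΓE⟩
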